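/- Let $A$ be a ring. A complex of $A$-modules is called perfect if it is quasi-isomorphic (that is, isomorphic in the derived category of $A$) to a finite complex $0\to P^a\to\cdots\to P^b\to 0$ of finitely generated projective $A$-modules; it is called perfect of length $\le r$ if this complex can be chosen with $b-a\le r$. The ring $A$ is called strongly regular if there is an integer $r\ge 0$ such that every perfect complex over $A$ is quasi-isomorphic to a finite direct sum of perfect complexes of length $\le r$. **Theorem 1.3.** A commutative noetherian ring $A$ is strongly regular if and only if it is isomorphic to a finite product $\prod_{i=1}^s A_i$ of rings ($s\ge 0$, the empty product being the zero ring), where each $A_i$ is a field or a Dedekind domain. -/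

import Mathlib

open CategoryTheory CategoryTheory.Limits

universe u

namespace StrongRegularity

variable {A : Type u} [Ring A]

/-- Two cochain complexes of `A`-modules are quasi-isomorphic if they become isomorphic
in the derived category of `A`. -/
def QuasiIsomorphic (K L : CochainComplex (ModuleCat.{u} A) ℤ) : Prop :=
  letI := HasDerivedCategory.standard (ModuleCat.{u} A)
  Nonempty (DerivedCategory.Q.obj K ≅ DerivedCategory.Q.obj L)

/-- `P` is a finite complex `0 → P^a → ⋯ → P^b → 0` of finite projective `A`-modules
(all the terms outside the degrees from `a` to `b` vanish). -/
structure IsFiniteProjectiveComplex (P : CochainComplex (ModuleCat.{u} A) ℤ) (a b : ℤ) :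
    Prop where
  finite : ∀ i, Module.Finite A (P.X i)
  projective : ∀ i, Module.Projective A (P.X i)
  strictlyGE : P.IsStrictlyGE a
  strictlyLE : P.IsStrictlyLE b

/-- A complex is perfect if it is quasi-isomorphic to a finite complex of finite projective
modules. -/
def IsPerfect (K : CochainComplex (ModuleCat.{u} A) ℤ) : Prop :=
  ∃ (P : CochainComplex (ModuleCat.{u} A) ℤ) (a b : ℤ),
    IsFiniteProjectiveComplex P a b ∧ QuasiIsomorphic K P

/-- A perfect complex of length at most `r`: it is quasi-isomorphic to a complex
`0 → P^a → ⋯ → P^b → 0` of finite projective modules with `b - a ≤ r`. -/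
def IsPerfectOfLengthLE (r : ℕ) (K : CochainComplex (ModuleCat.{u} A) ℤ) : Prop :=
  ∃ (P : CochainComplex (ModuleCat.{u} A) ℤ) (a b : ℤ),
    b - a ≤ r ∧ IsFiniteProjectiveComplex P a b ∧ QuasiIsomorphic K P

variable (A)

/-- `A` is strongly `r`-regular if every perfect complex over `A` is quasi-isomorphic to a
(finite) direct sum, i.e. coproduct, of perfect complexes of length at most `r`. -/
def IsStronglyRegularOfLength (r : ℕ) : Prop :=
  ∀ K : CochainComplex (ModuleCat.{u} A) ℤ, IsPerfect K →
    ∃ (s : ℕ) (F : Fin s → CochainComplex (ModuleCat.{u} A) ℤ),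
      (∀ i, IsPerfectOfLengthLE r (F i)) ∧ QuasiIsomorphic K (∐ F)

/-- `A` is strongly regular if it is strongly `r`-regular for some `r`. -/
def IsStronglyRegular : Prop :=
  ∃ r : ℕ, IsStronglyRegularOfLength A r

end StrongRegularity

/-! For finite products of Dedekind domains (fields included) every ideal is projective, hence so is
every submodule of a finite projective module. The image of each differential then splits off, and a
finite projective complex is the sum of its pieces `P^k / Z^k → Z^(k+1)`; so `r = 1` works.

Conversely, take a square-zero 2×2 matrix `N` with entries in a maximal ideal `m`, and the complex
of copies of `A²` in degrees `0` to `r + 1` with every differential `N`. A decomposition into pieces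
of length at most `r` makes the identity homotopic to a sum of endomorphisms, each zero in degree
`0` or `r + 1`. If intertwiners of `N` swap diagonal entries mod `m`, an alternating diagonal entry
of each summand is constant mod `m` along the complex, hence zero; the homotopy adds only terms in
`m`, so `1 ∈ m` (`not_isStronglyRegular_of_matrix`). Two choices of `N` show that the stalks at
maximal ideals are domains and then valuation rings (`locally_noZeroDivisors`, `locally_dvd_total`).
For noetherian `A`, the minimal primes are finite in number and comaximal with zero intersection,
and the Chinese remainder theorem gives the product. -/

/-! ### From conditions on stalks to products of Dedekind domains. -/

section CommutativeAlgebra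

/-- A noetherian domain in which, locally at every maximal ideal, any two elements are comparable
for divisibility is a Dedekind domain. -/
theorem isDedekindDomain_of_locally_dvd_total (B : Type*) [CommRing B] [IsDomain B]
    [IsNoetherianRing B]
    (h : ∀ m : Ideal B, m.IsMaximal → ∀ x y : B, ∃ s ∉ m, y ∣ s * x ∨ x ∣ s * y) :
    IsDedekindDomain B := by
  have : IsDedekindDomainDvr B := by
    refine { is_dvr_at_nonzero_prime := fun P hP hP' => ?_ }
    have hnf : ¬ IsField (Localization.AtPrime P) :=
      IsLocalization.AtPrime.not_isField B hP (Localization.AtPrime P)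
    have := IsLocalization.isNoetherianRing P.primeCompl (Localization.AtPrime P) inferInstance
    have := IsLocalization.isDomain_localization (le_nonZeroDivisors_of_noZeroDivisors
      (fun h : (0 : B) ∈ P.primeCompl => h P.zero_mem))
    refine ((IsDiscreteValuationRing.TFAE (Localization.AtPrime P) hnf).out 1 0).mp ?_
    rw [ValuationRing.iff_dvd_total]
    refine ⟨fun a b => ?_⟩
    obtain ⟨x, s, rfl⟩ := IsLocalization.exists_mk'_eq P.primeCompl a
    obtain ⟨y, t, rfl⟩ := IsLocalization.exists_mk'_eq P.primeCompl b
    obtain ⟨m, hm, hPm⟩ := P.exists_le_maximal hP'.ne_top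
    obtain ⟨r, hr, hxy⟩ := h m hm x y
    have hu : IsUnit (algebraMap B (Localization.AtPrime P) r) :=
      IsLocalization.map_units (Localization.AtPrime P) (⟨r, fun h => hr (hPm h)⟩ : P.primeCompl)
    have key : ∀ (x y : B) (s t : P.primeCompl), y ∣ r * x →
        IsLocalization.mk' (Localization.AtPrime P) y t ∣ IsLocalization.mk' _ x s := by
      intro x y s t hd
      have hd := map_dvd (algebraMap B (Localization.AtPrime P)) hd
      rw [map_mul, hu.dvd_mul_left] at hd
      rw [← IsLocalization.mk'_spec (Localization.AtPrime P) y t,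
        ← IsLocalization.mk'_spec (Localization.AtPrime P) x s,
        (IsLocalization.map_units (Localization.AtPrime P) s).dvd_mul_right,
        (IsLocalization.map_units (Localization.AtPrime P) t).mul_right_dvd] at hd
      exact hd
    exact hxy.symm.imp (key y x t s) (key x y s t)
  infer_instance

variable {A : Type u} [CommRing A]

/-- If `x ≠ 0` and `x² = 0`, the annihilator of `x` lies in some maximal `m`, while the hypothesis
at `m` for the pair `x, x` yields an annihilating element outside `m`. -/
theorem isReduced_of_locally_noZeroDivisors
    (h : ∀ m : Ideal A, m.IsMaximal → ∀ x y : A, x * y = 0 → ∃ s ∉ m, s * x = 0 ∨ s * y = 0) :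
    IsReduced A := by
  rw [isReduced_iff_pow_one_lt 2 one_lt_two]
  intro x hx
  by_contra hx0
  obtain ⟨m, hm, hle⟩ := (Ideal.span {x}).annihilator.exists_le_maximal (by
    rw [Ne, Ideal.eq_top_iff_one, Submodule.mem_annihilator_span_singleton]
    simpa using hx0)
  obtain ⟨s, hs, h0⟩ := h m hm x x (by rw [← sq, hx])
  refine hs (hle ?_)
  rw [Submodule.mem_annihilator_span_singleton]
  simpa using h0

/-- Distinct minimal primes of a ring with integral stalks are comaximal. -/
theorem isCoprime_of_mem_minimalPrimes_of_locally_noZeroDivisors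
    (h : ∀ m : Ideal A, m.IsMaximal → ∀ x y : A, x * y = 0 → ∃ s ∉ m, s * x = 0 ∨ s * y = 0)
    {p q : Ideal A} (hp : p ∈ minimalPrimes A) (hq : q ∈ minimalPrimes A) (hpq : p ≠ q) :
    IsCoprime p q := by
  rw [Ideal.isCoprime_iff_sup_eq]
  by_contra hne
  obtain ⟨m, hm, hle⟩ := Ideal.exists_le_maximal _ hne
  -- `T` is prime by the hypothesis and lies in every prime contained in `m`, so it equals each
  -- minimal prime contained in `m`.
  let T : Ideal A := RingHom.ker (algebraMap A (Localization.AtPrime m))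
  have hT (x : A) : x ∈ T ↔ ∃ s ∉ m, s * x = 0 := by
    rw [RingHom.mem_ker, IsLocalization.map_eq_zero_iff m.primeCompl]
    exact ⟨fun ⟨s, hs⟩ => ⟨s, s.2, hs⟩, fun ⟨s, hs, h0⟩ => ⟨⟨s, hs⟩, h0⟩⟩
  have hTprime : T.IsPrime := by
    refine ⟨RingHom.ker_ne_top _, fun {x y} hxy => ?_⟩
    obtain ⟨s, hs, h0⟩ := (hT _).mp hxy
    obtain ⟨t, ht, h0⟩ := h m hm (s * x) y (by rw [mul_assoc, h0])
    refine h0.imp (fun h0 => (hT x).mpr ⟨t * s, ?_, by rw [mul_assoc, h0]⟩)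
      (fun h0 => (hT y).mpr ⟨t, ht, h0⟩)
    exact fun hts => (hm.isPrime.mem_or_mem hts).elim ht hs
  have hTle {p : Ideal A} (hp : p ∈ minimalPrimes A) (hpm : p ≤ m) : T = p := by
    refine (hp.2 ⟨hTprime, bot_le⟩ ?_).antisymm' ?_ <;>
    · intro x hx
      obtain ⟨s, hs, h0⟩ := (hT x).mp hx
      exact (hp.isPrime.mem_or_mem (h0 ▸ p.zero_mem : s * x ∈ p)).resolve_left (fun h => hs (hpm h))
  exact hpq ((hTle hp (le_sup_left.trans hle)).symm.trans (hTle hq (le_sup_right.trans hle)))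

/-- A noetherian ring whose stalks are integral valuation rings is a finite product of Dedekind
domains. -/
theorem exists_ringEquiv_pi_isDedekindDomain [IsNoetherianRing A]
    (h₀ : ∀ m : Ideal A, m.IsMaximal → ∀ x y : A, x * y = 0 → ∃ s ∉ m, s * x = 0 ∨ s * y = 0)
    (h₁ : ∀ m : Ideal A, m.IsMaximal → ∀ x y : A, ∃ s ∉ m, y ∣ s * x ∨ x ∣ s * y) :
    ∃ (s : ℕ) (B : Fin s → Type u) (_ : ∀ i, CommRing (B i)),
      (∀ i, IsDedekindDomain (B i)) ∧ Nonempty (A ≃+* (∀ i, B i)) := by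
  have := isReduced_of_locally_noZeroDivisors h₀
  have hfin : Finite (minimalPrimes A) := Ideal.finite_minimalPrimes_of_isNoetherianRing A ⊥
  let e := (Finite.equivFin (minimalPrimes A)).symm
  let f : Fin (Nat.card (minimalPrimes A)) → Ideal A := fun i => (e i).1
  have hprime : ∀ i, (f i).IsPrime := fun i => Ideal.IsMinimalPrime.isPrime (e i).2
  have hcop : Pairwise (Function.onFun IsCoprime f) := fun i j hij =>
    isCoprime_of_mem_minimalPrimes_of_locally_noZeroDivisors h₀ (e i).2 (e j).2
      (fun h => hij (e.injective (Subtype.ext h)))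
  have hinf : ⨅ i, f i = ⊥ := by
    have : ⨅ i, f i = sInf (minimalPrimes A) := by
      rw [sInf_eq_iInf']
      exact e.iInf_comp (g := fun p : minimalPrimes A => (p : Ideal A))
    rw [this]
    exact (Ideal.sInf_minimalPrimes (I := (⊥ : Ideal A))).trans
      (nilradical_eq_zero A)
  refine ⟨_, fun i => A ⧸ f i, fun i => inferInstance, fun i => ?_,
    ⟨(RingEquiv.quotientBot A).symm.trans ((Ideal.quotEquivOfEq hinf.symm).trans
      (Ideal.quotientInfRingEquivPiQuotient f hcop))⟩⟩
  have := hprime i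
  refine isDedekindDomain_of_locally_dvd_total (A ⧸ f i) fun m hm x y => ?_
  obtain ⟨x, rfl⟩ := Ideal.Quotient.mk_surjective x
  obtain ⟨y, rfl⟩ := Ideal.Quotient.mk_surjective y
  obtain ⟨s, hs, h⟩ := h₁ (m.comap (Ideal.Quotient.mk (f i)))
    (Ideal.comap_isMaximal_of_surjective _ Ideal.Quotient.mk_surjective) x y
  refine ⟨Ideal.Quotient.mk (f i) s, hs, ?_⟩
  simp only [← map_mul]
  exact h.imp (map_dvd _) (map_dvd _)

end CommutativeAlgebra

/-! ### Projectivity of ideals and of submodules. -/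

section Hereditary

/-- Projectivity is transitive along projective ring extensions. -/
theorem Module.Projective.restrictScalars_of_projective (R S M : Type*) [CommRing R] [CommRing S]
    [Algebra R S] [AddCommGroup M] [Module R M] [Module S M] [IsScalarTower R S M]
    [Module.Projective R S] [Module.Projective S M] : Module.Projective R M := by
  classical
  obtain ⟨s, hs⟩ := (Module.projective_def' (R := S) (P := M)).mp inferInstance
  have : Module.Projective R (M →₀ S) := Module.Projective.of_equiv'
    ((finsuppLequivDFinsupp S (ι := M) (M := S)).symm.restrictScalars R)
  exact Module.Projective.of_split (s.restrictScalars R)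
    ((Finsupp.linearCombination S (id : M → M)).restrictScalars R)
    (LinearMap.ext fun x => LinearMap.congr_fun hs x)

variable {A : Type*} [CommRing A]

theorem Ideal.projective_of_isDedekindDomain [IsDedekindDomain A] (I : Ideal A) :
    Module.Projective A I := by
  have : Module.FinitePresentation A I := Module.finitePresentation_of_finite A I
  exact Module.Flat.projective_of_finitePresentation

/-- Every ideal of a finite product of Dedekind domains is projective. -/
theorem Ideal.projective_of_ringEquiv_pi {ι : Type*} [Finite ι] {B : ι → Type*}
    [∀ i, CommRing (B i)] [∀ i, IsDedekindDomain (B i)] (e : A ≃+* (∀ i, B i)) (I : Ideal A) :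
    Module.Projective A I := by
  classical
  have := Fintype.ofFinite ι
  let (i : ι) : Algebra A (B i) := ((Pi.evalRingHom B i).comp e.toRingHom).toAlgebra
  have hmap (i : ι) (a : A) : algebraMap A (B i) a = e a i := rfl
  have hsurj (i : ι) : Function.Surjective (algebraMap A (B i)) := fun b =>
    ⟨e.symm (Pi.single i b), by simp [hmap]⟩
  have hB (i : ι) : Module.Projective A (B i) := by
    have : Module.Projective A (∀ i, B i) := Module.Projective.of_equiv
      (LinearEquiv.ofBijective (Algebra.linearMap A (∀ i, B i)) e.bijective)
    exact Module.Projective.of_split (LinearMap.single A B i) (LinearMap.proj i)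
      (by ext; simp)
  let J (i : ι) : Ideal (B i) := I.map (algebraMap A (B i))
  have hJ (i : ι) : Module.Projective A (J i) := by
    have := Ideal.projective_of_isDedekindDomain (J i)
    exact Module.Projective.restrictScalars_of_projective A (B i) (J i)
  let φ : I →ₗ[A] (∀ i, J i) := LinearMap.pi fun i =>
    { toFun := fun x => ⟨algebraMap A (B i) x, Ideal.mem_map_of_mem _ x.2⟩
      map_add' := fun x y => Subtype.ext (by simp)
      map_smul' := fun a x => Subtype.ext (by simp [Algebra.smul_def]) }
  have hφ (x : I) (i : ι) : (φ x i : B i) = e x i := rfl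
  have hpi : Module.Projective A (∀ i, J i) :=
    Module.Projective.of_equiv' (DFinsupp.linearEquivFunOnFintype (R := A))
  refine Module.Projective.of_equiv' (LinearEquiv.ofBijective φ ⟨?_, ?_⟩).symm
  · intro x y hxy
    refine Subtype.ext (e.injective (funext fun i => ?_))
    rw [← hφ, ← hφ, hxy]
  · intro b
    have hb (i : ι) : ∃ a ∈ I, algebraMap A (B i) a = b i :=
      (Ideal.mem_map_iff_of_surjective _ (hsurj i)).mp (b i).2
    choose a ha hab using hb
    -- The elements `e.symm (Pi.single i 1)` are the idempotents of the factors; they glue the local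
    -- lifts.
    refine ⟨⟨∑ i, e.symm (Pi.single i 1) * a i, I.sum_mem fun i _ => I.mul_mem_left _ (ha i)⟩, ?_⟩
    refine funext fun i => Subtype.ext ?_
    rw [hφ, ← hab i, hmap]
    simp only [map_sum, map_mul, RingEquiv.apply_symm_apply, Finset.sum_apply, Pi.mul_apply]
    rw [Finset.sum_eq_single i (fun j _ hj => by simp [Pi.single_eq_of_ne' hj]) (by simp)]
    simp

/-- If all ideals are projective, so are all submodules of finite free modules. -/
theorem Submodule.projective_of_ideal_projective (h : ∀ I : Ideal A, Module.Projective A I) :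
    ∀ (n : ℕ) (N : Submodule A (Fin n → A)), Module.Projective A N := by
  intro n
  induction n with
  | zero => intro N; infer_instance
  | succ n ih =>
    intro N
    -- The first coordinate splits `N` as its kernel, embedded in `A^n`, plus its range, an ideal.
    let f : N →ₗ[A] A := (LinearMap.proj 0).comp N.subtype
    have := h (LinearMap.range f)
    obtain ⟨s, hs⟩ := Module.projective_lifting_property f.rangeRestrict LinearMap.id
      f.surjective_rangeRestrict
    let t : (Fin (n + 1) → A) →ₗ[A] (Fin n → A) := LinearMap.funLeft A A Fin.succ
    let g : LinearMap.ker f →ₗ[A] (Fin n → A) := t.comp (N.subtype.comp (LinearMap.ker f).subtype)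
    have hg : Function.Injective g := by
      intro x y hxy
      refine Subtype.ext (Subtype.ext (funext fun i => ?_))
      refine Fin.cases ?_ (fun j => ?_) i
      · exact (LinearMap.mem_ker.mp x.2).trans (LinearMap.mem_ker.mp y.2).symm
      · exact congr_fun hxy j
    have := ih (LinearMap.range g)
    have : Module.Projective A (LinearMap.ker f) :=
      Module.Projective.of_equiv (LinearEquiv.ofInjective g hg).symm
    have hs' (y : LinearMap.range f) : f (s y) = y := congr_arg Subtype.val (LinearMap.congr_fun hs y)
    let k : N →ₗ[A] LinearMap.ker f := (LinearMap.id - s.comp f.rangeRestrict).codRestrict _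
      (fun x => by simp [hs'])
    refine Module.Projective.of_split (M := LinearMap.ker f × LinearMap.range f)
      (k.prod f.rangeRestrict) ((LinearMap.ker f).subtype.coprod s) ?_
    ext x
    simp [k]

theorem Submodule.projective_of_ideal_projective' (h : ∀ I : Ideal A, Module.Projective A I)
    {M : Type*} [AddCommGroup M] [Module A M] [Module.Finite A M] [Module.Projective A M]
    (N : Submodule A M) : Module.Projective A N := by
  obtain ⟨n, f, g, -, hg, -⟩ := Module.Finite.exists_comp_eq_id_of_projective A M
  have := Submodule.projective_of_ideal_projective h n (N.map g)
  exact Module.Projective.of_equiv (N.equivMapOfInjective g hg).symm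

end Hereditary

/-! ### Splitting complexes over a hereditary ring. -/

namespace StrongRegularity

section DirectSum

variable {C : Type*} [Category* C] [Preadditive C] [IsIdempotentComplete C] [HasFiniteCoproducts C]

/-- A finite family of orthogonal idempotents with sum `1` decomposes an object as a coproduct of
their images. -/
theorem exists_iso_coproduct_of_orthogonal_idempotents {ι : Type} [Fintype ι] [DecidableEq ι]
    {X : C} (e : ι → (X ⟶ X)) (hid : ∀ i, e i ≫ e i = e i) (horth : ∀ i j, i ≠ j → e i ≫ e j = 0)
    (hsum : ∑ i, e i = 𝟙 X) :
    ∃ (F : ι → C) (i : ∀ k, F k ⟶ X) (p : ∀ k, X ⟶ F k), (∀ k, i k ≫ p k = 𝟙 (F k)) ∧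
      (∀ k, p k ≫ i k = e k) ∧ Nonempty (X ≅ ∐ F) := by
  choose F i p hip hpi using fun k => IsIdempotentComplete.idempotents_split X (e k) (hid k)
  let b : Bicone F :=
    { pt := X
      π := p
      ι := i
      ι_π := fun j k => by
        split_ifs with h
        · subst h
          simp [hip]
        · have : i j ≫ p k = i j ≫ (p j ≫ i j) ≫ (p k ≫ i k) ≫ p k := by
            simp [hip, reassoc_of% hip]
          rw [this, hpi, hpi, reassoc_of% (horth j k h)]
          simp }
  have hb : b.IsBilimit := isBilimitOfTotal b (by simpa [b, hpi] using hsum)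
  exact ⟨F, i, p, hip, hpi, ⟨hb.isColimit.coconePointUniqueUpToIso (colimit.isColimit _)⟩⟩

end DirectSum

section Ring

variable {A : Type u} [Ring A]

theorem QuasiIsomorphic.trans {K L M : CochainComplex (ModuleCat.{u} A) ℤ}
    (h : QuasiIsomorphic K L) (h' : QuasiIsomorphic L M) : QuasiIsomorphic K M :=
  ⟨h.some ≪≫ h'.some⟩

theorem QuasiIsomorphic.of_iso {K L : CochainComplex (ModuleCat.{u} A) ℤ} (e : K ≅ L) :
    QuasiIsomorphic K L :=
  letI := HasDerivedCategory.standard (ModuleCat.{u} A)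
  ⟨DerivedCategory.Q.mapIso e⟩

/-- A retract of a finite projective complex, by an idempotent vanishing outside of `[a, b]`. -/
theorem IsFiniteProjectiveComplex.of_retract {P F : CochainComplex (ModuleCat.{u} A) ℤ} {a b : ℤ}
    (hP : IsFiniteProjectiveComplex P a b) (i : F ⟶ P) (p : P ⟶ F) (hip : i ≫ p = 𝟙 F) {a' b' : ℤ}
    (ha : ∀ n < a', (p ≫ i).f n = 0) (hb : ∀ n, b' < n → (p ≫ i).f n = 0) :
    IsFiniteProjectiveComplex F a' b' := by
  have hip (n : ℤ) : i.f n ≫ p.f n = 𝟙 _ := by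
    rw [← HomologicalComplex.comp_f, hip, HomologicalComplex.id_f]
  have hzero (n : ℤ) (h : (p ≫ i).f n = 0) : IsZero (F.X n) := by
    rw [IsZero.iff_id_eq_zero]
    calc 𝟙 (F.X n) = i.f n ≫ (p.f n ≫ i.f n) ≫ p.f n := by simp [hip n]
      _ = 0 := by rw [HomologicalComplex.comp_f] at h; simp [h]
  have hlin (n : ℤ) : (p.f n).hom ∘ₗ (i.f n).hom = LinearMap.id := by
    rw [← ModuleCat.hom_comp, hip, ModuleCat.hom_id]
  refine ⟨fun n => ?_, fun n => ?_, ?_, ?_⟩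
  · have := hP.finite n
    exact Module.Finite.of_surjective (p.f n).hom
      (fun x => ⟨(i.f n).hom x, LinearMap.congr_fun (hlin n) x⟩)
  · have := hP.projective n
    exact Module.Projective.of_split (i.f n).hom (p.f n).hom (hlin n)
  · rw [CochainComplex.isStrictlyGE_iff]
    exact fun n hn => hzero n (ha n hn)
  · rw [CochainComplex.isStrictlyLE_iff]
    exact fun n hn => hzero n (hb n hn)

end Ring

section TwoTermProjection

variable {B : Type*} [Category* B] [Preadditive B] {P : CochainComplex B ℤ}

/-- The endomorphism of a complex which is `q k` in degree `k` and `1 - q (k + 1)` in degree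
`k + 1`, for endomorphisms `q n` through which the differentials factor. -/
def twoTermProjection (q : ∀ n, P.X n ⟶ P.X n) (hqd : ∀ n, q n ≫ P.d n (n + 1) = P.d n (n + 1))
    (hdq : ∀ n, P.d n (n + 1) ≫ q (n + 1) = 0) (k : ℤ) : P ⟶ P where
  f n := if n = k then q n else if n = k + 1 then 𝟙 _ - q n else 0
  comm' i j hij := by
    obtain rfl : i + 1 = j := hij
    by_cases h : i = k
    · subst h
      simp [hqd, hdq]
    · by_cases h' : i = k + 1
      · subst h'
        have h₂ : ¬ k + 1 + 1 = k := by lia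
        simp [hqd, h₂]
      · by_cases h'' : i + 1 = k
        · subst h''
          have h₂ : ¬ i = i + 1 + 1 := by lia
          simp [hdq, h₂]
        · simp [h, h', h'']

theorem twoTermProjection_f (q : ∀ n, P.X n ⟶ P.X n)
    (hqd : ∀ n, q n ≫ P.d n (n + 1) = P.d n (n + 1))
    (hdq : ∀ n, P.d n (n + 1) ≫ q (n + 1) = 0) (k n : ℤ) :
    (twoTermProjection q hqd hdq k).f n =
      if n = k then q n else if n = k + 1 then 𝟙 _ - q n else 0 := rfl

/-- Projections with adjacent indices overlap in one degree, where the product is `q (1 - q) = 0` in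
some order. -/
theorem twoTermProjection_comp (q : ∀ n, P.X n ⟶ P.X n)
    (hqd : ∀ n, q n ≫ P.d n (n + 1) = P.d n (n + 1))
    (hdq : ∀ n, P.d n (n + 1) ≫ q (n + 1) = 0) (hqq : ∀ n, q n ≫ q n = q n) (k l : ℤ) :
    twoTermProjection q hqd hdq k ≫ twoTermProjection q hqd hdq l =
      if k = l then twoTermProjection q hqd hdq k else 0 := by
  ext n
  rw [HomologicalComplex.comp_f, twoTermProjection_f, twoTermProjection_f]
  by_cases hkl : k = l
  · subst hkl
    rw [if_pos rfl, twoTermProjection_f]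
    split_ifs <;> simp [hqq]
  · rw [if_neg hkl, HomologicalComplex.zero_f]
    split_ifs <;> first | (exfalso; lia) | simp [hqq]

end TwoTermProjection

variable {A : Type u} [CommRing A]

/-- Over a hereditary ring, bounded complexes of finite projective modules are direct sums of
complexes concentrated in two adjacent degrees. -/
theorem isStronglyRegularOfLength_one_of_ideal_projective
    (h : ∀ I : Ideal A, Module.Projective A I) : IsStronglyRegularOfLength A 1 := by
  rintro K ⟨P, a, b, hP, hK⟩
  -- A section of `P^n → im d` makes `q` the projection onto a complement of `ker d`.
  have hq (n : ℤ) : ∃ q : P.X n ⟶ P.X n, q ≫ P.d n (n + 1) = P.d n (n + 1) ∧ q ≫ q = q ∧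
      ∀ (m : ℤ), P.d m n ≫ q = 0 := by
    have := hP.finite (n + 1)
    have := hP.projective (n + 1)
    let f := (P.d n (n + 1)).hom
    have := Submodule.projective_of_ideal_projective' h (LinearMap.range f)
    obtain ⟨s, hs⟩ := Module.projective_lifting_property f.rangeRestrict LinearMap.id
      f.surjective_rangeRestrict
    have hs' (y : LinearMap.range f) : f.rangeRestrict (s y) = y := LinearMap.congr_fun hs y
    have hsf (y : LinearMap.range f) : f (s y) = y := congr_arg Subtype.val (hs' y)
    refine ⟨ModuleCat.ofHom (s ∘ₗ f.rangeRestrict), ?_, ?_, fun m => ?_⟩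
    · ext x
      exact hsf (f.rangeRestrict x)
    · ext x
      exact congr_arg s (hs' (f.rangeRestrict x))
    · ext x
      have : f.rangeRestrict ((P.d m n).hom x) = 0 := Subtype.ext
        (LinearMap.congr_fun (congr_arg ModuleCat.Hom.hom (P.d_comp_d m n (n + 1))) x)
      exact (congr_arg s this).trans s.map_zero
  choose q hqd hqq hdq using hq
  -- The pieces start in degrees `a - 1, …, b`; the one starting in `a - 1` accounts for `ker d` in
  -- degree `a`.
  let s : ℕ := (b - a + 2).toNat
  let e (k : Fin s) : P ⟶ P := twoTermProjection q hqd (fun n => hdq (n + 1) n) (a - 1 + k)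
  have hf (k : Fin s) (n : ℤ) : (e k).f n =
      if n = a - 1 + k then q n else if n = a - 1 + k + 1 then 𝟙 _ - q n else 0 := rfl
  have hcomp (k l : Fin s) : e k ≫ e l = if k = l then e k else 0 := by
    refine (twoTermProjection_comp q hqd _ hqq _ _).trans (if_congr ?_ rfl rfl)
    simp [Fin.ext_iff]
  have hsum : ∑ k, e k = 𝟙 P := by
    ext1 n
    by_cases hn : a ≤ n ∧ n ≤ b
    · let k₀ : Fin s := ⟨(n - a).toNat, by lia⟩
      let k₁ : Fin s := ⟨(n - a + 1).toNat, by lia⟩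
      have h₀ : n = a - 1 + k₀ + 1 := by simp [k₀]; lia
      have h₁ : n = a - 1 + k₁ := by simp [k₁]; lia
      have h₀₁ : k₀ ≠ k₁ := by simp [k₀, k₁, Fin.ext_iff]; lia
      have hsum : (∑ k, e k).f n = ∑ k, (e k).f n :=
        map_sum (HomologicalComplex.Hom.fAddMonoidHom n) _ _
      rw [hsum, ← Finset.sum_subset (Finset.subset_univ {k₀, k₁}), Finset.sum_pair h₀₁, hf, hf,
        if_neg (by lia), if_pos h₀, if_pos h₁]
      · simp
      · intro k _ hk
        rw [hf, if_neg, if_neg]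
        · rintro h
          exact hk (by simp [Fin.ext_iff]; lia)
        · rintro h
          exact hk (by simp [Fin.ext_iff]; lia)
    · have : IsZero (P.X n) := by
        have := hP.strictlyGE
        have := hP.strictlyLE
        by_cases han : a ≤ n
        · exact P.isZero_of_isStrictlyLE b n (by lia)
        · exact P.isZero_of_isStrictlyGE a n (by lia)
      exact this.eq_of_src _ _
  obtain ⟨F, i, p, hip, hpi, ⟨α⟩⟩ := exists_iso_coproduct_of_orthogonal_idempotents e
    (fun k => by rw [hcomp, if_pos rfl]) (fun k l hkl => by rw [hcomp, if_neg hkl]) hsum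
  refine ⟨s, F, fun k => ⟨F k, a - 1 + k, a - 1 + k + 1, by simp, ?_, .of_iso (Iso.refl _)⟩,
    hK.trans (.of_iso α)⟩
  refine hP.of_retract (i k) (p k) (hip k) ?_ ?_ <;>
  · intro n hn
    rw [hpi, hf, if_neg (by lia), if_neg (by lia)]

end StrongRegularity

/-! ### From the derived category back to chain maps. -/

namespace StrongRegularity

section DerivedCategory

variable {C : Type*} [Category* C] [Abelian C] [HasDerivedCategory C]

/-- Out of a K-projective complex, derived morphisms are homotopy classes of chain maps. -/
theorem Q_map_surjective (K L : CochainComplex C ℤ) [K.IsKProjective] :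
    Function.Surjective (DerivedCategory.Q.map : (K ⟶ L) → _) := by
  intro φ
  obtain ⟨g, hg⟩ := (CochainComplex.IsKProjective.Qh_map_bijective K
    ((HomotopyCategory.quotient _ _).obj L)).surjective
    ((DerivedCategory.quotientCompQhIso C).hom.app K ≫ φ ≫
      (DerivedCategory.quotientCompQhIso C).inv.app L)
  obtain ⟨f, rfl⟩ := (HomotopyCategory.quotient _ _).map_surjective g
  refine ⟨f, ?_⟩
  rw [← cancel_epi ((DerivedCategory.quotientCompQhIso C).hom.app K),
    ← DerivedCategory.quotientCompQhIso_hom_naturality, hg]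
  simp

theorem nonempty_homotopy_of_Q_map_eq {K L : CochainComplex C ℤ} [K.IsKProjective] {f g : K ⟶ L}
    (h : DerivedCategory.Q.map f = DerivedCategory.Q.map g) : Nonempty (Homotopy f g) := by
  refine ⟨HomotopyCategory.homotopyOfEq _ _
    ((CochainComplex.IsKProjective.Qh_map_bijective K _).injective ?_)⟩
  rw [← cancel_mono ((DerivedCategory.quotientCompQhIso C).hom.app L),
    DerivedCategory.quotientCompQhIso_hom_naturality, h,
    DerivedCategory.quotientCompQhIso_hom_naturality]

end DerivedCategory

section Ring

variable {A : Type u} [Ring A]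

theorem IsFiniteProjectiveComplex.isKProjective {P : CochainComplex (ModuleCat.{u} A) ℤ} {a b : ℤ}
    (hP : IsFiniteProjectiveComplex P a b) : P.IsKProjective := by
  have := hP.strictlyLE
  have (n : ℤ) : CategoryTheory.Projective (P.X n) := by
    have := hP.projective n
    exact ModuleCat.projective_of_categoryTheory_projective (P.X n)
  exact P.isKProjective_of_projective b

theorem exists_orthogonal_sum_of_iso_coproduct {C : Type*} [Category* C] [Preadditive C]
    [HasFiniteCoproducts C] {s : ℕ} (F : Fin s → C) :
    ∃ π : ∀ i, ∐ F ⟶ F i, ∑ i, π i ≫ Sigma.ι F i = 𝟙 (∐ F) := by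
  have := HasFiniteBiproducts.of_hasFiniteCoproducts (C := C)
  refine ⟨fun i => (biproduct.isoCoproduct F).inv ≫ biproduct.π F i, ?_⟩
  have h (i : Fin s) : Sigma.ι F i = biproduct.ι F i ≫ (biproduct.isoCoproduct F).hom := by simp
  simp_rw [h, Category.assoc, ← Category.assoc (biproduct.π F _) (biproduct.ι F _),
    ← Preadditive.comp_sum, ← Preadditive.sum_comp, biproduct.total, Category.id_comp,
    Iso.inv_hom_id]

/-- If a finite projective complex is quasi-isomorphic to a coproduct of perfect complexes of
length at most `r`, then up to homotopy its identity is a sum of endomorphisms factoring through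
finite projective complexes of length at most `r`. -/
theorem exists_homotopy_id_sum {K : CochainComplex (ModuleCat.{u} A) ℤ} {a b : ℤ}
    (hK : IsFiniteProjectiveComplex K a b) {r s : ℕ}
    {F : Fin s → CochainComplex (ModuleCat.{u} A) ℤ} (hF : ∀ i, IsPerfectOfLengthLE r (F i))
    (h : QuasiIsomorphic K (∐ F)) :
    ∃ e : Fin s → (K ⟶ K), Nonempty (Homotopy (𝟙 K) (∑ i, e i)) ∧
      ∀ i, ∃ a b : ℤ, b - a ≤ r ∧ ∀ n, n < a ∨ b < n → (e i).f n = 0 := by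
  let := HasDerivedCategory.standard (ModuleCat.{u} A)
  have := hK.isKProjective
  choose P a' b' hab hP hFP using hF
  have hP' := fun i => (hP i).isKProjective
  obtain ⟨α⟩ := h
  let β (i : Fin s) := (hFP i).some
  obtain ⟨π, hπ⟩ := exists_orthogonal_sum_of_iso_coproduct F
  -- The `F i` need not be K-projective, so the lifts pass through their finite projective models `P
  -- i`.
  choose f hf using fun i => Q_map_surjective K (P i)
    (α.hom ≫ DerivedCategory.Q.map (π i) ≫ (β i).hom)
  choose g hg using fun i => Q_map_surjective (P i) K
    ((β i).inv ≫ DerivedCategory.Q.map (Sigma.ι F i) ≫ α.inv)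
  refine ⟨fun i => f i ≫ g i, nonempty_homotopy_of_Q_map_eq ?_,
    fun i => ⟨a' i, b' i, hab i, fun n hn => ?_⟩⟩
  · have hfg (i : Fin s) : DerivedCategory.Q.map (f i ≫ g i) =
        α.hom ≫ DerivedCategory.Q.map (π i ≫ Sigma.ι F i) ≫ α.inv := by
      simp [hf, hg]
    rw [Functor.map_sum]
    simp_rw [hfg]
    rw [← Preadditive.comp_sum, ← Preadditive.sum_comp, ← Functor.map_sum, hπ]
    simp
  · have : IsZero ((P i).X n) := by
      have := (hP i).strictlyGE
      have := (hP i).strictlyLE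
      exact hn.elim (fun h => (P i).isZero_of_isStrictlyGE (a' i) n h)
        (fun h => (P i).isZero_of_isStrictlyLE (b' i) n h)
    rw [HomologicalComplex.comp_f, this.eq_of_tgt ((f i).f n) 0, zero_comp]

end Ring

/-! ### Complexes with constant differential as obstructions. -/

section ConstantComplex

variable {A : Type u} [CommRing A] {V : Type u} [AddCommGroup V] [Module A V] (L : ℕ)

variable (A V) in
/-- The module `V` in degrees between `0` and `L`, and zero in other degrees. -/
abbrev IntervalModule (n : ℤ) : Type u := PLift (0 ≤ n ∧ n ≤ L) → V

variable (A V) in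
/-- The map from `V` to `V` placed in degree `n`. -/
def intervalIncl (n : ℤ) : ModuleCat.of A V ⟶ ModuleCat.of A (IntervalModule V L n) :=
  ModuleCat.ofHom (LinearMap.pi fun _ => LinearMap.id)

open Classical in
variable (A V) in
/-- The map to `V` from `V` placed in degree `n`. -/
noncomputable def intervalCoord (n : ℤ) :
    ModuleCat.of A (IntervalModule V L n) ⟶ ModuleCat.of A V :=
  ModuleCat.ofHom (if h : 0 ≤ n ∧ n ≤ L then LinearMap.proj ⟨h⟩ else 0)

theorem intervalIncl_coord {n : ℤ} (h₀ : 0 ≤ n) (h₁ : n ≤ L) :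
    intervalIncl A V L n ≫ intervalCoord A V L n = 𝟙 _ := by
  ext x
  simp [intervalIncl, intervalCoord, h₀, h₁]

/-- Used for `d ∘ d = 0`: in either case the composite of two differentials vanishes, through `N ≫ N
= 0` or through the zero factor. -/
theorem intervalIncl_coord_eq_or (n : ℤ) :
    intervalIncl A V L n ≫ intervalCoord A V L n = 𝟙 _ ∨
      intervalIncl A V L n ≫ intervalCoord A V L n = 0 := by
  by_cases h : 0 ≤ n ∧ n ≤ L
  · exact Or.inl (intervalIncl_coord L h.1 h.2)
  · exact Or.inr (by ext; simp [intervalCoord, h])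

/-- For an endomorphism `N` of square zero of a finite free module `V`, there is a complex
`V → V → ⋯ → V` in degrees from `0` to `L` with all differentials equal to `N`. -/
theorem exists_complex_of_comp_self_eq_zero [Module.Finite A V] [Module.Free A V]
    (N : ModuleCat.of A V ⟶ ModuleCat.of A V) (hN : N ≫ N = 0) :
    ∃ (K : CochainComplex (ModuleCat.{u} A) ℤ) (i : ∀ n, ModuleCat.of A V ⟶ K.X n)
      (p : ∀ n, K.X n ⟶ ModuleCat.of A V), IsFiniteProjectiveComplex K 0 L ∧
      (∀ n : ℤ, 0 ≤ n → n ≤ L → i n ≫ p n = 𝟙 _) ∧ ∀ n, K.d n (n + 1) = p n ≫ N ≫ i (n + 1) := by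
  have hzero (n : ℤ) (hn : ¬ (0 ≤ n ∧ n ≤ L)) :
      IsZero (ModuleCat.of A (IntervalModule V L n)) := by
    have : Subsingleton (IntervalModule V L n) := ⟨fun x y => funext fun h => (hn h.down).elim⟩
    exact ModuleCat.isZero_of_subsingleton _
  refine ⟨CochainComplex.of (fun n => ModuleCat.of A (IntervalModule V L n))
    (fun n => intervalCoord A V L n ≫ N ≫ intervalIncl A V L (n + 1)) fun n => ?_,
    intervalIncl A V L, intervalCoord A V L, ⟨fun n => ?_, fun n => ?_, ?_, ?_⟩,
    fun n => intervalIncl_coord L, fun n => by simp only [CochainComplex.of_d]⟩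
  · rcases intervalIncl_coord_eq_or (A := A) (V := V) L (n + 1) with h | h <;>
      simp [reassoc_of% h, reassoc_of% hN]
  · exact inferInstanceAs (Module.Finite A (IntervalModule V L n))
  · have : Module.Free A (IntervalModule V L n) := Module.Free.function _ _ _
    exact inferInstanceAs (Module.Projective A (IntervalModule V L n))
  · rw [CochainComplex.isStrictlyGE_iff]
    exact fun n hn => hzero n (by lia)
  · rw [CochainComplex.isStrictlyLE_iff]
    exact fun n hn => hzero n (by lia)

/-- A complex `V → V → ⋯ → V` with constant differential and of length greater than `r` is not a
direct sum of complexes of length at most `r`, provided that it is minimal and connected as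
measured by functionals `ρ n`. -/
theorem not_isStronglyRegularOfLength_of_functionals {r : ℕ} [Module.Finite A V] [Module.Free A V]
    (N : ModuleCat.of A V ⟶ ModuleCat.of A V) (hN : N ≫ N = 0) (m : Ideal A) (hm : m ≠ ⊤)
    (ρ : ℤ → (V →ₗ[A] V) →ₗ[A] A) (h_one : ρ 0 LinearMap.id = 1)
    (h_min : ∀ X, ρ 0 (X ∘ₗ N.hom) ∈ m)
    (h_conn : ∀ n E E', E' ∘ₗ N.hom = N.hom ∘ₗ E → ρ (n + 1) E' - ρ n E ∈ m) :
    ¬ IsStronglyRegularOfLength A r := by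
  intro hreg
  obtain ⟨K, i, p, hK, hip, hd⟩ := exists_complex_of_comp_self_eq_zero (r + 1) N hN
  obtain ⟨s, F, hF, hKF⟩ := hreg K ⟨_, _, _, hK, .of_iso (Iso.refl _)⟩
  obtain ⟨e, ⟨H⟩, he⟩ := exists_homotopy_id_sum hK hF hKF
  have hcomm (k : Fin s) (n : ℤ) (h₀ : 0 ≤ n) (h₁ : n + 1 ≤ (r + 1 : ℕ)) :
      N ≫ (i (n + 1) ≫ (e k).f (n + 1) ≫ p (n + 1)) = (i n ≫ (e k).f n ≫ p n) ≫ N := by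
    have h := i n ≫= (e k).comm n (n + 1) =≫ p (n + 1)
    have h₂ := hip n h₀ (by lia)
    have h₃ := hip (n + 1) (by lia) h₁
    simp only [hd, Category.assoc, h₃, reassoc_of% h₂, Category.comp_id] at h ⊢
    exact h.symm
  have hconst (k : Fin s) (j : ℕ) (hj : j ≤ r + 1) :
      ρ j (i j ≫ (e k).f j ≫ p j).hom - ρ 0 (i 0 ≫ (e k).f 0 ≫ p 0).hom ∈ m := by
    induction j with
    | zero => simp
    | succ j ih =>
      have h : ρ (j + 1) (i (j + 1) ≫ (e k).f (j + 1) ≫ p (j + 1)).hom -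
          ρ j (i j ≫ (e k).f j ≫ p j).hom ∈ m := h_conn j _ _ (congr_arg ModuleCat.Hom.hom (hcomm k j (by lia) (by lia)))
      have h := m.add_mem h (ih (by lia))
      rw [sub_add_sub_cancel] at h
      exact h
  have hzero (k : Fin s) : ρ 0 (i 0 ≫ (e k).f 0 ≫ p 0).hom ∈ m := by
    obtain ⟨a, b, hab, hn⟩ := he k
    -- An interval of length at most `r` cannot contain both `0` and `r + 1`.
    obtain ⟨j, hj, hjab⟩ : ∃ j : ℕ, j ≤ r + 1 ∧ ((j : ℤ) < a ∨ b < j) := by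
      by_cases ha : 0 < a
      · exact ⟨0, by lia, by lia⟩
      · exact ⟨r + 1, le_rfl, by lia⟩
    have h := hconst k j hj
    rw [hn j hjab, zero_comp, comp_zero, ModuleCat.hom_zero, map_zero, zero_sub, neg_mem_iff] at h
    exact h
  have hH := H.comm 0
  -- Nothing lives in degree `-1`, so in degree `0` the homotopy contributes only a term factoring
  -- through `N`.
  have hprev : prevD 0 H.hom = 0 := by
    have := hK.strictlyGE
    rw [prevD_eq _ (show (ComplexShape.up ℤ).Rel (-1) 0 by simp),
      (K.isZero_of_isStrictlyGE 0 (-1)).eq_of_tgt (H.hom 0 (-1)) 0, zero_comp]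
  have hsum : (∑ k, e k).f 0 = ∑ k, (e k).f 0 :=
    map_sum (HomologicalComplex.Hom.fAddMonoidHom 0) _ _
  rw [hprev, add_zero, dNext_eq _ (show (ComplexShape.up ℤ).Rel 0 (0 + 1) by simp), hsum,
    hd, HomologicalComplex.id_f] at hH
  have hH := i 0 ≫= hH =≫ p 0
  have h₀ := hip 0 le_rfl (by lia)
  have hid : 𝟙 _ = N ≫ (i (0 + 1) ≫ H.hom (0 + 1) 0 ≫ p 0) +
      ∑ k, i 0 ≫ (e k).f 0 ≫ p 0 := by
    simp only [Category.assoc, Preadditive.add_comp, Preadditive.comp_add, reassoc_of% h₀,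
      Category.id_comp, h₀, Preadditive.sum_comp, Preadditive.comp_sum] at hH
    exact hH
  have hid := congr_arg ModuleCat.Hom.hom hid
  rw [ModuleCat.hom_id, ModuleCat.hom_add, ModuleCat.hom_comp, ModuleCat.hom_sum] at hid
  refine hm ((Ideal.eq_top_iff_one m).mpr ?_)
  rw [← h_one, hid, map_add, map_sum]
  exact m.add_mem (h_min _) (m.sum_mem fun k _ => hzero k)

end ConstantComplex

/-- An endomorphism `N` of `A²` of square zero with entries in `m` such that the intertwiners
between `N` and itself swap the diagonal entries modulo `m` obstructs strong regularity. -/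
theorem not_isStronglyRegular_of_matrix {A : Type u} [CommRing A] (N : Matrix (Fin 2) (Fin 2) A)
    (hN : N * N = 0) (m : Ideal A) (hm : m ≠ ⊤) (hNm : ∀ i j, N i j ∈ m)
    (h : ∀ E E' : Matrix (Fin 2) (Fin 2) A, E' * N = N * E →
      E' 0 0 - E 1 1 ∈ m ∧ E' 1 1 - E 0 0 ∈ m) : ¬ IsStronglyRegular A := by
  rintro ⟨r, hr⟩
  let entry (i : Fin 2) : ((Fin 2 → A) →ₗ[A] (Fin 2 → A)) →ₗ[A] A :=
    Matrix.entryLinearMap A A i i ∘ₗ LinearMap.toMatrix'.toLinearMap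
  have hentry (i : Fin 2) (X) : entry i X = LinearMap.toMatrix' X i i := rfl
  -- Each differential swaps the diagonal entries mod `m`, so the tracked entry alternates with the
  -- parity of the degree.
  refine not_isStronglyRegularOfLength_of_functionals (ModuleCat.ofHom (Matrix.toLin' N)) ?_ m hm
    (fun n => if Even n then entry 0 else entry 1) ?_ ?_ ?_ hr
  · rw [← ModuleCat.ofHom_comp, ← Matrix.toLin'_mul, hN, map_zero]
    rfl
  · simp [hentry]
  · intro X
    simp only [Even.zero, if_true, hentry, ModuleCat.hom_ofHom, LinearMap.toMatrix'_comp,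
      LinearMap.toMatrix'_toLin', Matrix.mul_apply]
    exact m.sum_mem fun i _ => m.mul_mem_left _ (hNm i 0)
  · intro n E E' hEE'
    have := h (LinearMap.toMatrix' E) (LinearMap.toMatrix' E') (by
      have := congr_arg LinearMap.toMatrix' hEE'
      simpa only [ModuleCat.hom_ofHom, LinearMap.toMatrix'_comp, LinearMap.toMatrix'_toLin']
        using this)
    by_cases hn : Even n
    · have hn' : ¬ Even (n + 1) := by simpa [Int.even_add_one] using hn
      simp only [hn, hn', if_true, if_false]
      exact this.2
    · have hn' : Even (n + 1) := by simpa [Int.even_add_one] using hn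
      simp only [hn, hn', if_true, if_false]
      exact this.1

variable {A : Type u} [CommRing A]

/-- The stalks of a strongly regular ring have no zero divisors. -/
theorem IsStronglyRegular.locally_noZeroDivisors (hA : IsStronglyRegular A) (m : Ideal A)
    (hm : m.IsMaximal) (x y : A) (hxy : x * y = 0) : ∃ s ∉ m, s * x = 0 ∨ s * y = 0 := by
  by_contra! h
  have hx : x ∈ m := by
    by_contra hx
    exact (h x hx).2 hxy
  have hy : y ∈ m := by
    by_contra hy
    exact (h y hy).1 (by rw [mul_comm, hxy])
  -- Off-diagonal entries of the intertwining relation read `(E'₀₀ - E₁₁) x = 0` and `(E'₁₁ - E₀₀) y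
  -- = 0`; both annihilators lie in `m`.
  refine not_isStronglyRegular_of_matrix !![0, x; y, 0] ?_ m hm.ne_top ?_ ?_ hA
  · ext i j
    fin_cases i <;> fin_cases j <;> simp [Matrix.mul_apply, hxy, mul_comm y x]
  · intro i j
    fin_cases i <;> fin_cases j <;> simp [hx, hy]
  · intro E E' hE
    have h₀₁ := congr_fun (congr_fun hE 0) 1
    have h₁₀ := congr_fun (congr_fun hE 1) 0
    simp [Matrix.mul_apply, Fin.sum_univ_two] at h₀₁ h₁₀
    constructor
    · by_contra hs
      exact (h _ hs).1 (by linear_combination h₀₁)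
    · by_contra hs
      exact (h _ hs).2 (by linear_combination h₁₀)

/-- In the stalks of a strongly regular ring, any two elements are comparable for divisibility. -/
theorem IsStronglyRegular.locally_dvd_total (hA : IsStronglyRegular A) (m : Ideal A)
    (hm : m.IsMaximal) (x y : A) : ∃ s ∉ m, y ∣ s * x ∨ x ∣ s * y := by
  by_contra! h
  have hx : x ∈ m := by
    by_contra hx
    exact (h x hx).2 (dvd_mul_right _ _)
  have hy : y ∈ m := by
    by_contra hy
    exact (h y hy).1 (dvd_mul_right _ _)
  -- Cancelling `y` in the stalk turns the relation into `a y = b x`; a unit `a` would make `x`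
  -- divide `y` there.
  have key : ∀ x y : A, (∀ s ∉ m, ¬ x ∣ s * y) → ∀ a b : A, a * (y * y) = b * (x * y) → a ∈ m := by
    intro x y h a b hab
    by_contra ha
    obtain ⟨s, hs, h0⟩ := hA.locally_noZeroDivisors m hm (a * y - b * x) y
      (by linear_combination hab)
    rcases h0 with h0 | h0
    · exact h (s * a) (fun hsa => (hm.isPrime.mem_or_mem hsa).elim hs ha)
        ⟨s * b, by linear_combination h0⟩
    · exact h s hs (h0 ▸ dvd_zero x)
  -- The matrix is the column `(-y, x)` times the row `(x, y)`, whose product in the other order is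
  -- `0`.
  refine not_isStronglyRegular_of_matrix !![-(x * y), -(y * y); x * x, x * y] ?_ m hm.ne_top ?_ ?_
    hA
  · ext i j
    fin_cases i <;> fin_cases j <;> simp [Matrix.mul_apply] <;> ring
  · intro i j
    fin_cases i <;> fin_cases j <;> simp [m.mul_mem_left, hx, hy]
  · intro E E' hE
    have h₀₁ := congr_fun (congr_fun hE 0) 1
    have h₁₀ := congr_fun (congr_fun hE 1) 0
    simp [Matrix.mul_apply, Fin.sum_univ_two] at h₀₁ h₁₀
    exact ⟨key x y (fun s hs => (h s hs).2) _ (E 0 1 + E' 0 1) (by linear_combination -h₀₁),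
      key y x (fun s hs => (h s hs).1) _ (E 1 0 + E' 1 0) (by linear_combination h₁₀)⟩

end StrongRegularity

theorem theorem1p3 (A : Type u) [CommRing A] [IsNoetherianRing A] :
    StrongRegularity.IsStronglyRegular A ↔
      ∃ (s : ℕ) (B : Fin s → Type u) (_ : ∀ i, CommRing (B i)),
        (∀ i, IsField (B i) ∨ IsDedekindDomain (B i)) ∧ Nonempty (A ≃+* (∀ i, B i)) := by
  constructor
  · intro hA
    obtain ⟨s, B, hB, hd, he⟩ := exists_ringEquiv_pi_isDedekindDomain
      hA.locally_noZeroDivisors hA.locally_dvd_total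
    -- `IsDedekindDomain` admits fields, so the field alternative is never needed here.
    exact ⟨s, B, hB, fun i => Or.inr (hd i), he⟩
  · rintro ⟨s, B, hB, hd, ⟨e⟩⟩
    have hd' (i : Fin s) : IsDedekindDomain (B i) := by
      refine (hd i).elim (fun h => ?_) id
      let := h.toField
      infer_instance
    exact ⟨1, StrongRegularity.isStronglyRegularOfLength_one_of_ideal_projective
      (Ideal.projective_of_ringEquiv_pi e)⟩
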